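/- Consider sequential bilateral trade over a horizon of $T$ steps. A sequence $\mathcal S=((s_t,b_t))_{t=1}^T$ of seller and buyer valuations in $[0,1]^2$ is fixed in advance. At each step $t$ a learner posts prices $p_t,q_t\in[0,1]$ to the seller and to the buyer, with $p_t\le q_t$ (two-price mechanisms) or $p_t=q_t$ (single-price mechanisms), and gains $$\mathrm{GFT}_t(p_t,q_t)=\mathbf 1\{s_t\le p_t\le q_t\le b_t\}\,(b_t-s_t).$$ In the full-feedback model $(s_t,b_t)$ is revealed to the learner after step $t$, so $(p_t,q_t)$ may depend on $(s_1,b_1),\dots,(s_{t-1},b_{t-1})$ and on the internal randomization of the learner. The minimax $2$-regret is $$R_T^{2,\star}=\inf_{\mathcal A}\ \sup_{\mathcal S}\ \Big\{\max_{p,q\in[0,1]}\sum_{t=1}^T \mathrm{GFT}_t(p,q)-2\sum_{t=1}^T\mathbb E\big[\mathrm{GFT}_t(p_t,q_t)\big]\Big\},$$ where $\mathcal A$ ranges over all randomized full-feedback learners of the class considered and the expectation is over the internal randomization of $\mathcal A$. Theorem. In the full-feedback model, both for two-price and for single-price mechanisms, there is a $T_0$ such that for all horizons $T\ge T_0$,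 $$R_T^{2,\star}\ \ge\ \tfrac1{13}\sqrt T .$$ -/

import Mathlib

open MeasureTheory

universe u

namespace BilateralTrade

/-- The set `[0,1]` in which prices and valuations lie. -/
abbrev Unit01 : Type := Set.Icc (0 : ℝ) 1

/-- A pair of valuations `(s, b)`: the seller's and the buyer's. -/
abbrev Valuation : Type := Unit01 × Unit01

/-- A pair of prices `(p, q)`: `p` is posted to the seller and `q` to the buyer. -/
abbrev Prices : Type := Unit01 × Unit01

open Classical in
/-- The gain from trade of the prices `(p, q)` at the valuations `(s, b)`, that is
`𝟙{s ≤ p ≤ q ≤ b} (b - s)`. -/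
noncomputable def gft (x : Prices) (v : Valuation) : ℝ :=
  if v.1 ≤ x.1 ∧ x.1 ≤ x.2 ∧ x.2 ≤ v.2 then (v.2 : ℝ) - (v.1 : ℝ) else 0

/-- The part of a valuation sequence that full feedback has revealed before step `t`:
the valuations of all earlier steps. -/
def history {T : ℕ} (S : Fin T → Valuation) (t : Fin T) : Fin t → Valuation :=
  fun i => S ⟨i, i.2.trans t.2⟩

/-- A randomized learning algorithm with full feedback on the horizon `T`: it draws an internal
random seed `ω` from some probability space, and the prices that it posts at step `t` are a
function of the seed and of the valuations of the steps before `t` (its own earlier prices are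
themselves functions of these data). For each history the prices are random variables. -/
structure Learner (T : ℕ) where
  /-- the space of seeds of the internal randomization -/
  Ω : Type u
  /-- its σ-algebra -/
  mΩ : MeasurableSpace Ω
  /-- the law of the seed -/
  μ : Measure Ω
  isProb : IsProbabilityMeasure μ
  /-- the prices posted at step `t` -/
  price : (t : Fin T) → (Fin t → Valuation) → Ω → Prices
  measurable_price : ∀ t h, Measurable (price t h)

/-- Two price mechanisms: the price posted to the seller never exceeds that of the buyer. -/
def twoPrice (T : ℕ) : Set (Learner.{u} T) :=
  {A | ∀ t h ω, (A.price t h ω).1 ≤ (A.price t h ω).2}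

/-- Single price mechanisms: both agents are always offered the same price. -/
def singlePrice (T : ℕ) : Set (Learner.{u} T) :=
  {A | ∀ t h ω, (A.price t h ω).1 = (A.price t h ω).2}

/-- The total gain from trade of the best fixed prices in hindsight. (A supremum of a nonempty set
of reals contained in `[0, T]`.) -/
noncomputable def bestFixed {T : ℕ} (S : Fin T → Valuation) : ℝ :=
  ⨆ x : Prices, ∑ t, gft x (S t)

namespace Learner

/-- The expected gain from trade of the learner at step `t` against the sequence `S`. -/
noncomputable def expectedGft {T : ℕ} (A : Learner.{u} T) (S : Fin T → Valuation) (t : Fin T) : ℝ :=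
  letI := A.mΩ
  ∫ ω, gft (A.price t (history S t) ω) (S t) ∂A.μ

/-- The `α`-regret of the learner against the sequence `S`. -/
noncomputable def regretAgainst {T : ℕ} (A : Learner.{u} T) (α : ℝ) (S : Fin T → Valuation) : ℝ :=
  bestFixed S - α * ∑ t, A.expectedGft S t

/-- The `α`-regret of the learner: its regret against the worst valuation sequence. -/
noncomputable def regret {T : ℕ} (A : Learner.{u} T) (α : ℝ) : EReal :=
  ⨆ S : Fin T → Valuation, (A.regretAgainst α S : EReal)

end Learner

/-- The minimax `α`-regret on the horizon `T` over a class of full-feedback learners. -/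
noncomputable def minimaxRegret (α : ℝ) (T : ℕ) (C : Set (Learner.{u} T)) : EReal :=
  ⨅ A ∈ C, A.regret α

end BilateralTrade

namespace BilateralTrade

open Finset

/-! ### Averages over ternary strings -/

/-! The valuations are drawn from a uniform ternary string. Each letter selects one of three
disjoint intervals of length about `1/3`, separated by gaps of order `ε` near `1/3` and `2/3`. The
intervals depend only on earlier letters, and no price pair trades in two of them, so every learner
gains about `1/9` per step on average (`sum_gft_triple_le`, `Learner.sum_expectedGft_update_le`).

In hindsight, a hidden price near `1/3` trades whenever the letter is `0` or `1`, and one near `2/3`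
whenever it is `1` or `2`: the gaps follow a ternary expansion whose limit is on the required side
of each (`le_gft_low`, `le_gft_high`). Each price gains about `2T/9` on average, which twice the
learner's gain cancels. The better of the two gains about `|walk| / 6` more, and a moment bound
makes this at least `√2 / 18 * √T` on average (`le_sum_abs_walk`), where `√2 / 18 > 1 / 13`. -/

/-- Averaging over all strings may be done by resampling one coordinate first. -/
lemma three_mul_sum_eq_sum_update {T : ℕ} (t : Fin T) (f : (Fin T → Fin 3) → ℝ) :
    3 * ∑ c, f c = ∑ c : Fin T → Fin 3, ∑ k, f (Function.update c t k) := by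
  classical
  let e := Equiv.funSplitAt t (Fin 3)
  have key : ∀ g : (Fin T → Fin 3) → ℝ, ∑ c, g c = ∑ h, ∑ a, g (e.symm (a, h)) := by
    intro g
    rw [← Equiv.sum_comp e.symm g, Fintype.sum_prod_type, sum_comm]
  have hup : ∀ a h k, Function.update (e.symm (a, h)) t k = e.symm (k, h) := by
    intro a h k
    funext j
    by_cases hj : j = t
    · subst hj; simp [e, Equiv.funSplitAt, Equiv.piSplitAt]
    · simp [e, Equiv.funSplitAt, Equiv.piSplitAt, hj]
  rw [key, key, mul_sum]
  refine sum_congr rfl fun h _ => ?_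
  simp only [hup, sum_const, card_univ, Fintype.card_fin, nsmul_eq_mul]
  norm_num

lemma sum_sum_le_of_sum_update_le {T : ℕ} (F : Fin T → (Fin T → Fin 3) → ℝ) (M : ℝ)
    (h : ∀ t c, ∑ k, F t (Function.update c t k) ≤ M) :
    ∑ c, ∑ t, F t c ≤ 3 ^ T * (T * (M / 3)) := by
  rw [sum_comm]
  have : ∀ t, ∑ c, F t c ≤ 3 ^ T * (M / 3) := by
    intro t
    have h1 := three_mul_sum_eq_sum_update t (F t)
    have h2 : ∑ c : Fin T → Fin 3, ∑ k, F t (Function.update c t k) ≤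
        ∑ c : Fin T → Fin 3, M := sum_le_sum fun c _ => h t c
    simp only [sum_const, card_univ, Fintype.card_pi, Fintype.card_fin, prod_const,
      nsmul_eq_mul, Nat.cast_pow, Nat.cast_ofNat] at h2
    linarith
  calc ∑ t, ∑ c, F t c ≤ ∑ _t : Fin T, 3 ^ T * (M / 3) := sum_le_sum fun t _ => this t
    _ = _ := by simp; ring

/-- The step of the lazy random walk that is driven by a ternary string. -/
def walkStep : Fin 3 → ℝ := ![1, 0, -1]

/-- The endpoint of the lazy random walk that is driven by a ternary string. -/
def walk {n : ℕ} (c : Fin n → Fin 3) : ℝ := ∑ i, walkStep (c i)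

lemma sum_walk_succ (n : ℕ) (F : ℝ → ℝ) :
    ∑ c : Fin (n + 1) → Fin 3, F (walk c) =
      ∑ c : Fin n → Fin 3, (F (walk c + 1) + F (walk c) + F (walk c - 1)) := by
  rw [← Equiv.sum_comp (Fin.consEquiv fun _ => Fin 3), Fintype.sum_prod_type, sum_comm]
  refine sum_congr rfl fun c _ => ?_
  simp only [walk, Fin.consEquiv_apply, Fin.sum_univ_succ, Fin.cons_zero,
    Fin.cons_succ, walkStep]
  simp [add_comm, add_left_comm, sub_eq_add_neg]

lemma sum_walk_sq (n : ℕ) :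
    ∑ c : Fin n → Fin 3, walk c ^ 2 = 3 ^ n * (2 / 3 * n) := by
  induction n with
  | zero => simp [walk]
  | succ n ih =>
    rw [sum_walk_succ n fun x => x ^ 2]
    have : ∀ c : Fin n → Fin 3,
        (walk c + 1) ^ 2 + walk c ^ 2 + (walk c - 1) ^ 2 = 3 * walk c ^ 2 + 2 := fun c => by ring
    simp only [this, sum_add_distrib, ← mul_sum, ih]
    simp
    ring

lemma sum_walk_pow_four (n : ℕ) :
    ∑ c : Fin n → Fin 3, walk c ^ 4 = 3 ^ n * (4 / 3 * n ^ 2 - 2 / 3 * n) := by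
  induction n with
  | zero => simp [walk]
  | succ n ih =>
    rw [sum_walk_succ n fun x => x ^ 4]
    have : ∀ c : Fin n → Fin 3, (walk c + 1) ^ 4 + walk c ^ 4 + (walk c - 1) ^ 4 =
        3 * walk c ^ 4 + 12 * walk c ^ 2 + 2 := fun c => by ring
    simp only [this, sum_add_distrib, ← mul_sum, ih, sum_walk_sq]
    simp
    ring

/-- The even quartic touches `|x|` at `0` and is tangent to it at `|x| = r`. It turns second and
fourth moments into a lower bound on the first absolute moment. -/
lemma quartic_le_abs {r : ℝ} (hr : 0 < r) (x : ℝ) :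
    3 / (2 * r) * x ^ 2 - 1 / (2 * r ^ 3) * x ^ 4 ≤ |x| := by
  have h2 : x ^ 2 = |x| ^ 2 := (sq_abs x).symm
  have h4 : x ^ 4 = |x| ^ 4 := by rw [show x ^ 4 = (x ^ 2) ^ 2 by ring, h2]; ring
  rw [h2, h4]
  set y := |x|
  have hy : 0 ≤ y := abs_nonneg x
  have : y - (3 / (2 * r) * y ^ 2 - 1 / (2 * r ^ 3) * y ^ 4) =
      y * (y - r) ^ 2 * (y + 2 * r) / (2 * r ^ 3) := by
    field_simp
    ring
  have h0 : 0 ≤ y * (y - r) ^ 2 * (y + 2 * r) / (2 * r ^ 3) := by positivity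
  linarith

lemma le_sum_abs_walk (n : ℕ) :
    3 ^ n * (√2 / 3 * √n) ≤ ∑ c : Fin n → Fin 3, |walk c| := by
  rcases Nat.eq_zero_or_pos n with rfl | hn
  · simp [walk]
  have hn' : (0 : ℝ) < n := by exact_mod_cast hn
  -- `r ^ 2 = 2 * n` is the leading-order ratio of the fourth to the second moment, which optimizes
  -- the bound.
  have hr : 0 < √2 * √n := by positivity
  have hr2 : (√2 * √n) ^ 2 = 2 * n := by
    rw [mul_pow, Real.sq_sqrt (by norm_num), Real.sq_sqrt hn'.le]
  set r := √2 * √n with hrdef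
  have h := sum_le_sum fun (c : Fin n → Fin 3) (_ : c ∈ univ) => quartic_le_abs hr (walk c)
  rw [sum_sub_distrib, ← mul_sum, ← mul_sum, sum_walk_sq, sum_walk_pow_four] at h
  refine le_trans ?_ h
  have hnr : (n : ℝ) = r ^ 2 / 2 := by linarith
  have e : 3 / (2 * r) * (3 ^ n * (2 / 3 * (n : ℝ))) -
      1 / (2 * r ^ 3) * (3 ^ n * (4 / 3 * (n : ℝ) ^ 2 - 2 / 3 * n)) =
      3 ^ n * (r / 3) + 3 ^ n * (1 / (6 * r)) := by
    rw [hnr]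
    field_simp
    ring
  have : (0 : ℝ) ≤ 3 ^ n * (1 / (6 * r)) := by positivity
  rw [e, show √2 / 3 * √n = r / 3 by rw [hrdef]; ring]
  linarith

/-! ### Ternary expansions that track a hidden point -/

/-- The signed ternary expansion, up to the digit `t`, of a string with digit signs `σ`. -/
noncomputable def center (σ : Fin 3 → ℝ) (e : ℕ → Fin 3) (t : ℕ) : ℝ :=
  ∑ i ∈ range t, σ (e i) * (1 / 3) ^ (i + 1)

/-- Geometric tail: all digits after `t` together move the center by less than half of `(1 / 3) ^
t`, so they cannot carry it back across a gap that digit `t` has left. -/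
lemma abs_center_sub_le {σ : Fin 3 → ℝ} (hσ : ∀ k, |σ k| ≤ 1) (e : ℕ → Fin 3) {t n : ℕ}
    (h : t ≤ n) : |center σ e n - center σ e t| ≤ ((1 / 3) ^ t - (1 / 3) ^ n) / 2 := by
  induction n, h using Nat.le_induction with
  | base => simp
  | succ n _ ih =>
    have h1 : center σ e (n + 1) = center σ e n + σ (e n) * (1 / 3) ^ (n + 1) :=
      sum_range_succ _ _
    have h2 : |σ (e n) * (1 / 3) ^ (n + 1)| ≤ (1 / 3) ^ (n + 1) := by
      rw [abs_mul, abs_of_pos (by positivity : (0 : ℝ) < (1 / 3) ^ (n + 1))]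
      exact mul_le_of_le_one_left (by positivity) (hσ _)
    have h3 : ((1 : ℝ) / 3) ^ n = 3 * (1 / 3) ^ (n + 1) := by ring
    rw [h3] at ih
    rw [h1]
    rw [abs_le] at *
    constructor <;> linarith [ih.1, ih.2, h2.1, h2.2]

lemma center_congr (σ : Fin 3 → ℝ) {e e' : ℕ → Fin 3} {t : ℕ} (h : ∀ i < t, e i = e' i) :
    center σ e t = center σ e' t :=
  sum_congr rfl fun i hi => by rw [h i (mem_range.1 hi)]

/-- The last point left of the gap around the center. -/
noncomputable def gapLeft (σ : Fin 3 → ℝ) (e : ℕ → Fin 3) (t : ℕ) : ℝ :=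
  center σ e t - (1 / 3) ^ (t + 1) / 2

/-- The first point right of the gap around the center. -/
noncomputable def gapRight (σ : Fin 3 → ℝ) (e : ℕ → Fin 3) (t : ℕ) : ℝ :=
  center σ e t + (1 / 3) ^ (t + 1) / 2

section

variable {σ : Fin 3 → ℝ} (hσ : ∀ k, |σ k| ≤ 1) (e : ℕ → Fin 3)
include hσ

lemma abs_center_le (t : ℕ) : |center σ e t| ≤ 1 / 2 := by
  have h := abs_center_sub_le hσ e (Nat.zero_le t)
  have h0 : center σ e 0 = 0 := by simp [center]
  rw [h0, sub_zero, pow_zero] at h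
  have : (0 : ℝ) < (1 / 3) ^ t := by positivity
  linarith

lemma abs_gap_le (t : ℕ) : |gapLeft σ e t| ≤ 1 / 2 ∧ |gapRight σ e t| ≤ 1 / 2 := by
  have h := abs_center_sub_le hσ e (Nat.zero_le t)
  have h0 : center σ e 0 = 0 := by simp [center]
  rw [h0, sub_zero, pow_zero, show ((1 : ℝ) / 3) ^ t = 3 * (1 / 3) ^ (t + 1) by ring, abs_le] at h
  have : (0 : ℝ) < (1 / 3) ^ (t + 1) := by positivity
  simp only [gapLeft, gapRight, abs_le]
  refine ⟨⟨?_, ?_⟩, ?_, ?_⟩ <;> linarith [h.1, h.2]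

lemma center_le_gapLeft {t n : ℕ} (h : t < n) (ht : σ (e t) = -1) :
    center σ e n ≤ gapLeft σ e t := by
  have h1 : center σ e (t + 1) = center σ e t + σ (e t) * (1 / 3) ^ (t + 1) := sum_range_succ _ _
  have h2 := (abs_le.1 (abs_center_sub_le hσ e (Nat.succ_le_of_lt h))).2
  have : (0 : ℝ) < (1 / 3) ^ n := by positivity
  rw [ht] at h1
  simp only [Nat.succ_eq_add_one] at h2
  rw [gapLeft]
  linarith

lemma gapRight_le_center {t n : ℕ} (h : t < n) (ht : σ (e t) = 1) :
    gapRight σ e t ≤ center σ e n := by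
  have h1 : center σ e (t + 1) = center σ e t + σ (e t) * (1 / 3) ^ (t + 1) := sum_range_succ _ _
  have h2 := (abs_le.1 (abs_center_sub_le hσ e (Nat.succ_le_of_lt h))).1
  have : (0 : ℝ) < (1 / 3) ^ n := by positivity
  rw [ht] at h1
  simp only [Nat.succ_eq_add_one] at h2
  rw [gapRight]
  linarith

end

lemma gapLeft_lt_gapRight (σ : Fin 3 → ℝ) (e : ℕ → Fin 3) (t : ℕ) :
    gapLeft σ e t < gapRight σ e t := by
  have : (0 : ℝ) < (1 / 3) ^ (t + 1) := by positivity
  rw [gapLeft, gapRight]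
  linarith

/-! ### The hard valuation sequences -/

/-- The digit signs that track the hidden price near `1/3`. -/
def lowSign : Fin 3 → ℝ := ![-1, 1, 0]

/-- The digit signs that track the hidden price near `2/3`. -/
def highSign : Fin 3 → ℝ := ![0, -1, 1]

lemma abs_lowSign_le (k : Fin 3) : |lowSign k| ≤ 1 := by
  fin_cases k <;> simp [lowSign]

lemma abs_highSign_le (k : Fin 3) : |highSign k| ≤ 1 := by
  fin_cases k <;> simp [highSign]

/-- Projection of a real number to the unit interval. -/
noncomputable def toUnit (x : ℝ) : Unit01 := Set.projIcc 0 1 zero_le_one x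

lemma coe_toUnit {x : ℝ} (h0 : 0 ≤ x) (h1 : x ≤ 1) : (toUnit x : ℝ) = x := by
  rw [toUnit, Set.projIcc_of_mem zero_le_one ⟨h0, h1⟩]

lemma coe_toUnit_third {ε z : ℝ} (h0 : 0 ≤ ε) (h1 : ε ≤ 1 / 3) (hz : |z| ≤ 1 / 2) :
    (toUnit (1 / 3 + ε * z) : ℝ) = 1 / 3 + ε * z := by
  have := abs_le.1 hz
  apply coe_toUnit <;> nlinarith

lemma coe_toUnit_two_thirds {ε z : ℝ} (h0 : 0 ≤ ε) (h1 : ε ≤ 1 / 3) (hz : |z| ≤ 1 / 2) :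
    (toUnit (2 / 3 + ε * z) : ℝ) = 2 / 3 + ε * z := by
  have := abs_le.1 hz
  apply coe_toUnit <;> nlinarith

/-- Three disjoint intervals of length about `1/3`, whose gaps are placed by the first `t` letters
of `e`. -/
noncomputable def triple (ε : ℝ) (e : ℕ → Fin 3) (t : ℕ) : Fin 3 → Valuation :=
  ![(toUnit 0, toUnit (1 / 3 + ε * gapLeft lowSign e t)),
    (toUnit (1 / 3 + ε * gapRight lowSign e t), toUnit (2 / 3 + ε * gapLeft highSign e t)),
    (toUnit (2 / 3 + ε * gapRight highSign e t), toUnit 1)]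

lemma triple_congr (ε : ℝ) {e e' : ℕ → Fin 3} {t : ℕ} (h : ∀ i < t, e i = e' i) :
    triple ε e t = triple ε e' t := by
  simp only [triple, gapLeft, gapRight, center_congr _ h]

/-- A finite string, continued arbitrarily. -/
def extend {T : ℕ} (c : Fin T → Fin 3) (i : ℕ) : Fin 3 := if h : i < T then c ⟨i, h⟩ else 0

/-- The valuation sequence that a ternary string selects. -/
noncomputable def hardSeq {T : ℕ} (ε : ℝ) (c : Fin T → Fin 3) (t : Fin T) : Valuation :=
  triple ε (extend c) t (c t)

lemma extend_coe {T : ℕ} (c : Fin T → Fin 3) (t : Fin T) : extend c t = c t := by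
  simp [extend]

lemma extend_update {T : ℕ} (c : Fin T → Fin 3) (t : Fin T) (k : Fin 3) {i : ℕ} (h : i < t) :
    extend (Function.update c t k) i = extend c i := by
  have hi : i < T := h.trans t.2
  have : (⟨i, hi⟩ : Fin T) ≠ t := fun h' => by rw [← h'] at h; exact lt_irrefl _ h
  simp [extend, hi, this]

/-- Full feedback before step `t` carries no information about the letter `t`. -/
lemma history_update {T : ℕ} (ε : ℝ) (c : Fin T → Fin 3) (t : Fin T) (k : Fin 3) :
    history (hardSeq ε (Function.update c t k)) t = history (hardSeq ε c) t := by
  funext i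
  have hi : (⟨i, i.2.trans t.2⟩ : Fin T) ≠ t := fun h => by
    have := congrArg Fin.val h
    exact absurd this (ne_of_lt i.2)
  simp only [history, hardSeq]
  rw [Function.update_of_ne hi]
  exact congrFun (triple_congr ε fun j hj => extend_update c t k (lt_trans hj i.2)) _

lemma hardSeq_update {T : ℕ} (ε : ℝ) (c : Fin T → Fin 3) (t : Fin T) (k : Fin 3) :
    hardSeq ε (Function.update c t k) t = triple ε (extend c) t k := by
  rw [hardSeq, Function.update_self]
  exact congrFun (triple_congr ε fun j hj => extend_update c t k hj) _

section

variable {ε : ℝ} (h0 : 0 < ε) (h1 : ε ≤ 1 / 3)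
include h0 h1

/-- No prices trade in two intervals of a triple. -/
lemma sum_gft_triple_le (e : ℕ → Fin 3) (t : ℕ) (x : Prices) :
    ∑ k, gft x (triple ε e t k) ≤ 1 / 3 + ε := by
  obtain ⟨hl, hr⟩ := abs_gap_le abs_lowSign_le e t
  obtain ⟨hl', hr'⟩ := abs_gap_le abs_highSign_le e t
  have g := mul_lt_mul_of_pos_left (gapLeft_lt_gapRight lowSign e t) h0
  have g' := mul_lt_mul_of_pos_left (gapLeft_lt_gapRight highSign e t) h0
  have c1 := coe_toUnit_third h0.le h1 hl
  have c2 := coe_toUnit_third h0.le h1 hr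
  have c3 := coe_toUnit_two_thirds h0.le h1 hl'
  have c4 := coe_toUnit_two_thirds h0.le h1 hr'
  rw [abs_le] at hl hr hl' hr'
  have b1 := mul_le_mul_of_nonneg_left hl.2 h0.le
  have b2 := mul_le_mul_of_nonneg_left hr.1 h0.le
  have b3 := mul_le_mul_of_nonneg_left hl'.2 h0.le
  have b4 := mul_le_mul_of_nonneg_left hr'.1 h0.le
  have b5 := mul_le_mul_of_nonneg_left hl.1 h0.le
  have b6 := mul_le_mul_of_nonneg_left hr'.2 h0.le
  have z := coe_toUnit le_rfl zero_le_one
  have o := coe_toUnit zero_le_one le_rfl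
  simp only [Fin.sum_univ_three, gft, triple, Matrix.cons_val_zero, Matrix.cons_val_one,
    Matrix.cons_val, ← Subtype.coe_le_coe, c1, c2, c3, c4, z, o]
  have b7 := mul_le_mul_of_nonneg_left hr.2 h0.le
  -- Trading in two intervals would contradict the strict gaps `g`, `g'`; otherwise at most one
  -- length remains.
  split_ifs <;> linarith

/-- `lowSign` sends the hidden point left of the gap on letter `0`, right of it on letter `1`, and
leaves it in place on letter `2`, where no trade is claimed. -/
lemma le_gft_low {T : ℕ} (c : Fin T → Fin 3) (t : Fin T) :
    (1 / 3 - ε) * (![1, 1, 0] : Fin 3 → ℝ) (c t) ≤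
      gft (toUnit (1 / 3 + ε * center lowSign (extend c) T),
        toUnit (1 / 3 + ε * center lowSign (extend c) T)) (hardSeq ε c t) := by
  obtain ⟨hl, hr⟩ := abs_gap_le abs_lowSign_le (extend c) t
  obtain ⟨hl', hr'⟩ := abs_gap_le abs_highSign_le (extend c) t
  have hc := abs_center_le abs_lowSign_le (extend c) T
  have c1 := coe_toUnit_third h0.le h1 hl
  have c2 := coe_toUnit_third h0.le h1 hr
  have c3 := coe_toUnit_two_thirds h0.le h1 hl'
  have c4 := coe_toUnit_two_thirds h0.le h1 hr'
  have c5 := coe_toUnit_third h0.le h1 hc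
  have z := coe_toUnit le_rfl zero_le_one
  have o := coe_toUnit zero_le_one le_rfl
  have pl := fun h => mul_le_mul_of_nonneg_left
    (center_le_gapLeft abs_lowSign_le (extend c) t.2 h) h0.le
  have pr := fun h => mul_le_mul_of_nonneg_left
    (gapRight_le_center abs_lowSign_le (extend c) t.2 h) h0.le
  rw [extend_coe] at pl pr
  rw [abs_le] at hl hr hl' hr' hc
  have b1 := mul_le_mul_of_nonneg_left hl.1 h0.le
  have b2 := mul_le_mul_of_nonneg_left hr.2 h0.le
  have b3 := mul_le_mul_of_nonneg_left hl'.1 h0.le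
  have b4 := mul_le_mul_of_nonneg_left hr'.2 h0.le
  have b5 := mul_le_mul_of_nonneg_left hc.1 h0.le
  have b6 := mul_le_mul_of_nonneg_left hc.2 h0.le
  rw [hardSeq]
  generalize c t = k at *
  fin_cases k
  · have p := pl (by simp [lowSign])
    simp only [gft, triple, Fin.zero_eta, Matrix.cons_val_zero, ← Subtype.coe_le_coe, c1, c5, z]
    rw [if_pos ⟨by linarith, le_rfl, by linarith⟩]
    linarith
  · have p := pr (by simp [lowSign])
    simp only [gft, triple, Fin.mk_one, Matrix.cons_val_one, Matrix.cons_val_zero,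
      ← Subtype.coe_le_coe, c2, c3, c5]
    rw [if_pos ⟨by linarith, le_rfl, by linarith⟩]
    linarith
  · simp only [gft, triple, Fin.reduceFinMk, Matrix.cons_val, ← Subtype.coe_le_coe, c4, c5, o,
      mul_zero]
    split_ifs <;> linarith

lemma le_gft_high {T : ℕ} (c : Fin T → Fin 3) (t : Fin T) :
    (1 / 3 - ε) * (![0, 1, 1] : Fin 3 → ℝ) (c t) ≤
      gft (toUnit (2 / 3 + ε * center highSign (extend c) T),
        toUnit (2 / 3 + ε * center highSign (extend c) T)) (hardSeq ε c t) := by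
  obtain ⟨hl, hr⟩ := abs_gap_le abs_lowSign_le (extend c) t
  obtain ⟨hl', hr'⟩ := abs_gap_le abs_highSign_le (extend c) t
  have hc := abs_center_le abs_highSign_le (extend c) T
  have c1 := coe_toUnit_third h0.le h1 hl
  have c2 := coe_toUnit_third h0.le h1 hr
  have c3 := coe_toUnit_two_thirds h0.le h1 hl'
  have c4 := coe_toUnit_two_thirds h0.le h1 hr'
  have c5 := coe_toUnit_two_thirds h0.le h1 hc
  have z := coe_toUnit le_rfl zero_le_one
  have o := coe_toUnit zero_le_one le_rfl
  have pl := fun h => mul_le_mul_of_nonneg_left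
    (center_le_gapLeft abs_highSign_le (extend c) t.2 h) h0.le
  have pr := fun h => mul_le_mul_of_nonneg_left
    (gapRight_le_center abs_highSign_le (extend c) t.2 h) h0.le
  rw [extend_coe] at pl pr
  rw [abs_le] at hl hr hl' hr' hc
  have b1 := mul_le_mul_of_nonneg_left hl.1 h0.le
  have b2 := mul_le_mul_of_nonneg_left hr.2 h0.le
  have b3 := mul_le_mul_of_nonneg_left hl'.1 h0.le
  have b4 := mul_le_mul_of_nonneg_left hr'.2 h0.le
  have b5 := mul_le_mul_of_nonneg_left hc.1 h0.le
  have b6 := mul_le_mul_of_nonneg_left hc.2 h0.le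
  rw [hardSeq]
  generalize c t = k at *
  fin_cases k
  · simp only [gft, triple, Fin.zero_eta, Matrix.cons_val_zero, ← Subtype.coe_le_coe, c1, c5, z,
      mul_zero]
    split_ifs <;> linarith
  · have p := pl (by simp [highSign])
    simp only [gft, triple, Fin.mk_one, Matrix.cons_val_one, Matrix.cons_val_zero,
      ← Subtype.coe_le_coe, c2, c3, c5]
    rw [if_pos ⟨by linarith, le_rfl, by linarith⟩]
    linarith
  · have p := pr (by simp [highSign])
    simp only [gft, triple, Fin.reduceFinMk, Matrix.cons_val, ← Subtype.coe_le_coe, c4, c5, o]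
    rw [if_pos ⟨by linarith, le_rfl, by linarith⟩]
    linarith

end

/-! ### The regret on the hard sequences -/

lemma gft_mem_Icc (x : Prices) (v : Valuation) : gft x v ∈ Set.Icc (0 : ℝ) 1 := by
  unfold gft
  split_ifs with h
  · have : (v.1 : ℝ) ≤ v.2 := h.1.trans (h.2.1.trans h.2.2)
    exact ⟨by linarith, by linarith [v.1.2.1, v.2.2.2]⟩
  · simp

lemma measurable_gft (v : Valuation) : Measurable fun x : Prices => gft x v := by
  unfold gft
  have m1 : MeasurableSet {x : Prices | v.1 ≤ x.1} := measurableSet_le measurable_const measurable_fst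
  have m2 : MeasurableSet {x : Prices | x.1 ≤ x.2} := measurableSet_le measurable_fst measurable_snd
  have m3 : MeasurableSet {x : Prices | x.2 ≤ v.2} := measurableSet_le measurable_snd measurable_const
  exact Measurable.ite (m1.inter (m2.inter m3)) measurable_const measurable_const

lemma sum_gft_le_bestFixed {T : ℕ} (S : Fin T → Valuation) (x : Prices) :
    ∑ t, gft x (S t) ≤ bestFixed S := by
  refine le_ciSup (f := fun x : Prices => ∑ t, gft x (S t)) ⟨T, ?_⟩ x
  rintro _ ⟨y, rfl⟩
  calc ∑ t, gft y (S t) ≤ ∑ _t : Fin T, (1 : ℝ) := sum_le_sum fun t _ => (gft_mem_Icc _ _).2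
    _ = T := by simp

/-- The maximum of two numbers is half of their sum plus half of their distance; the two trade
counts differ by exactly `walk c`. -/
lemma le_bestFixed_hardSeq {T : ℕ} {ε : ℝ} (h0 : 0 < ε) (h1 : ε ≤ 1 / 3) (c : Fin T → Fin 3) :
    (1 / 3 - ε) * ((∑ t, (![1, 2, 1] : Fin 3 → ℝ) (c t) + |walk c|) / 2) ≤
      bestFixed (hardSeq ε c) := by
  have hl := (sum_le_sum fun t (_ : t ∈ univ) => le_gft_low h0 h1 c t).trans
    (sum_gft_le_bestFixed _ _)
  have hh := (sum_le_sum fun t (_ : t ∈ univ) => le_gft_high h0 h1 c t).trans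
    (sum_gft_le_bestFixed _ _)
  rw [← mul_sum] at hl hh
  have e1 : ∑ t, (![1, 2, 1] : Fin 3 → ℝ) (c t) =
      ∑ t, (![1, 1, 0] : Fin 3 → ℝ) (c t) + ∑ t, (![0, 1, 1] : Fin 3 → ℝ) (c t) := by
    rw [← sum_add_distrib]
    refine sum_congr rfl fun t _ => ?_
    generalize c t = k
    fin_cases k <;> norm_num
  have e2 : walk c =
      ∑ t, (![1, 1, 0] : Fin 3 → ℝ) (c t) - ∑ t, (![0, 1, 1] : Fin 3 → ℝ) (c t) := by
    rw [← sum_sub_distrib]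
    refine sum_congr rfl fun t _ => ?_
    generalize c t = k
    fin_cases k <;> norm_num [walkStep]
  rw [e1, e2]
  rcases abs_cases (∑ t, (![1, 1, 0] : Fin 3 → ℝ) (c t) -
      ∑ t, (![0, 1, 1] : Fin 3 → ℝ) (c t)) with ⟨h, _⟩ | ⟨h, _⟩ <;> rw [h] <;> ring_nf at hl hh ⊢
  · exact hl
  · exact hh

lemma le_sum_bestFixed {ε : ℝ} (h0 : 0 < ε) (h1 : ε ≤ 1 / 3) (T : ℕ) :
    3 ^ T * ((1 / 3 - ε) * (2 / 3 * T + √2 / 6 * √T)) ≤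
      ∑ c : Fin T → Fin 3, bestFixed (hardSeq ε c) := by
  have h := sum_le_sum fun (c : Fin T → Fin 3) (_ : c ∈ univ) => le_bestFixed_hardSeq h0 h1 c
  refine le_trans ?_ h
  rw [← mul_sum, ← sum_div, sum_add_distrib]
  have hc := sum_sum_le_of_sum_update_le
    -- Negated, since a lower bound is needed; `4 = 1 + 2 + 1`.
    (fun (t : Fin T) (c : Fin T → Fin 3) => -(![1, 2, 1] : Fin 3 → ℝ) (c t)) (-4) (fun t c => by
      simp only [Function.update_self, Fin.sum_univ_three, Matrix.cons_val]
      norm_num)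
  simp only [sum_neg_distrib] at hc
  have hw := le_sum_abs_walk T
  have hε : 0 ≤ 1 / 3 - ε := by linarith
  have := mul_le_mul_of_nonneg_left (add_le_add (neg_le_neg hc) hw) hε
  rw [neg_neg] at this
  linarith

lemma Learner.sum_expectedGft_update_le {T : ℕ} (A : Learner.{u} T) {ε : ℝ} (h0 : 0 < ε)
    (h1 : ε ≤ 1 / 3) (t : Fin T) (c : Fin T → Fin 3) :
    ∑ k, A.expectedGft (hardSeq ε (Function.update c t k)) t ≤ 1 / 3 + ε := by
  let := A.mΩ
  have := A.isProb
  -- Now the same random prices face all three intervals, so the pointwise bound can be integrated.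
  simp only [Learner.expectedGft, history_update, hardSeq_update]
  have hint : ∀ k, Integrable (fun ω => gft (A.price t (history (hardSeq ε c) t) ω)
      (triple ε (extend c) t k)) A.μ := fun k =>
    Integrable.of_mem_Icc 0 1
      ((measurable_gft _).comp (A.measurable_price _ _)).aemeasurable
      (Filter.Eventually.of_forall fun ω => gft_mem_Icc _ _)
  rw [← integral_finsetSum _ fun k _ => hint k]
  calc _ ≤ ∫ _ω, (1 / 3 + ε) ∂A.μ :=
        integral_mono (integrable_finsetSum _ fun k _ => hint k) (integrable_const _)
          fun ω => sum_gft_triple_le h0 h1 _ _ _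
    _ = 1 / 3 + ε := by simp

lemma Learner.exists_le_regretAgainst {T : ℕ} (A : Learner.{u} T) {ε : ℝ} (h0 : 0 < ε)
    (h1 : ε ≤ 1 / 3) :
    ∃ S, √2 / 18 * √T - ε * (4 / 3 * T + √2 / 6 * √T) ≤ A.regretAgainst 2 S := by
  have hL := sum_sum_le_of_sum_update_le
    (fun t (c : Fin T → Fin 3) => A.expectedGft (hardSeq ε c) t) _
    (A.sum_expectedGft_update_le h0 h1)
  have hB := le_sum_bestFixed h0 h1 T
  have hsum : ∑ _c : Fin T → Fin 3, (√2 / 18 * √T - ε * (4 / 3 * T + √2 / 6 * √T)) ≤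
      ∑ c : Fin T → Fin 3, A.regretAgainst 2 (hardSeq ε c) := by
    simp only [Learner.regretAgainst, sum_sub_distrib, ← mul_sum]
    simp only [sum_const, card_univ, Fintype.card_pi, Fintype.card_fin, prod_const,
      nsmul_eq_mul, Nat.cast_pow, Nat.cast_ofNat]
    linarith
  obtain ⟨c, -, hc⟩ := exists_le_of_sum_le univ_nonempty hsum
  exact ⟨_, hc⟩

lemma Learner.le_regret {T : ℕ} (hT : 10 ^ 8 ≤ T) (A : Learner.{u} T) :
    ((√(T : ℝ) / 13 : ℝ) : EReal) ≤ A.regret 2 := by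
  have hT' : (10 : ℝ) ^ 8 ≤ T := by exact_mod_cast hT
  have hpos : (0 : ℝ) < T := lt_of_lt_of_le (by norm_num) hT'
  have hs : (10 : ℝ) ^ 4 ≤ √T := Real.le_sqrt_of_sq_le (by linarith)
  have hsq : √(T : ℝ) ^ 2 = T := Real.sq_sqrt hpos.le
  have h2l : (1.4142 : ℝ) ≤ √2 := Real.le_sqrt_of_sq_le (by norm_num)
  have h2u : √(2 : ℝ) ≤ 1.5 := Real.sqrt_le_iff.2 ⟨by norm_num, by norm_num⟩
  -- With `ε = 1 / T` the gaps cost at most `2` in total, which the slack `√2 / 18 - 1 / 13` times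
  -- `√T ≥ 10 ^ 4` absorbs.
  have hε : (0 : ℝ) < 1 / T := by positivity
  have hε' : (1 : ℝ) / T ≤ 1 / 3 := one_div_le_one_div_of_le (by norm_num) (by linarith)
  obtain ⟨S, hS⟩ := A.exists_le_regretAgainst hε hε'
  refine le_trans ?_ (le_iSup (fun S => (A.regretAgainst 2 S : EReal)) S)
  rw [EReal.coe_le_coe_iff]
  refine le_trans ?_ hS
  have hle : √(T : ℝ) ≤ T := by nlinarith
  have h6 : √2 / 6 * √(T : ℝ) ≤ 1 / 4 * T :=
    mul_le_mul (by linarith) hle (by positivity) (by norm_num)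
  have hloss : (1 : ℝ) / T * (4 / 3 * T + √2 / 6 * √T) ≤ 2 := by
    rw [one_div, inv_mul_le_iff₀ hpos]
    linarith
  have := mul_le_mul_of_nonneg_right h2l (by linarith : 0 ≤ √(T : ℝ))
  linarith

end BilateralTrade

theorem theorem3 :
    ∃ T₀ : ℕ, ∀ T : ℕ, T₀ ≤ T →
      ((Real.sqrt (T : ℝ) / 13 : ℝ) : EReal) ≤
          BilateralTrade.minimaxRegret 2 T (BilateralTrade.twoPrice.{u} T) ∧
        ((Real.sqrt (T : ℝ) / 13 : ℝ) : EReal) ≤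
          BilateralTrade.minimaxRegret 2 T (BilateralTrade.singlePrice.{u} T) := by
  refine ⟨10 ^ 8, fun T hT => ⟨?_, ?_⟩⟩ <;>
    exact le_iInf₂ fun A _ => A.le_regret hT
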